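/- Let $G$ be a finite simple graph with at most one isolated vertex and no isolated edge (a connected component consisting of a single edge); such a graph is called vdec. For an integer $k\ge 1$, an edge-$k$-coloring of $G$ assigns to each edge of $G$ a color from $\{1,\dots,k\}$ so that adjacent edges receive different colors; it is vertex-distinguishing if, for any two distinct vertices $u,v$ of $G$, the set of colors on the edges incident with $u$ differs from the set of colors on the edges incident with $v$. Let $\chi'_{vd}(G)$ be the least integer $k\ge 1$ such that $G$ has a vertex-distinguishing edge-$k$-coloring. Let $n_d$ be the number of vertices of degree $d$ in $G$, let $\delta(G)$ and $\Delta(G)$ be the minimum and maximum degree of $G$, and let $$k(G)=\min\Big\{k\in\mathbb{N}:\binom{k}{d}\ge n_d\ \text{ for every integer } d \text{ with } \delta(G)\le d\le\Delta(G)\Big\},$$ where $0\in\mathbb{N}$. Then a vertex-distinguishing edge-$k$-coloring of $G$ exists for some $k$, and $$\chi'_{vd}(G)\le\lfloor 5.5\,k(G)+6.5\rfloor .$$ -/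

import Mathlib

namespace SimpleGraph

/-- The edge `uv` is isolated: `u` and `v` are adjacent and have no other neighbours. -/
def IsIsolatedEdge {V : Type*} (G : SimpleGraph V) (u v : V) : Prop :=
  G.Adj u v ∧ (∀ w, G.Adj u w → w = v) ∧ (∀ w, G.Adj v w → w = u)

/-- A graph is vdec if it has at most one isolated vertex and no isolated edge. -/
def IsVdec {V : Type*} (G : SimpleGraph V) : Prop :=
  (∀ u v, G.IsIsolated u → G.IsIsolated v → u = v) ∧ ∀ u v, ¬ G.IsIsolatedEdge u v

/-- A proper edge coloring of `G` with `k` colors: any two distinct edges with a common end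
receive different colors, that is, a proper vertex coloring of the line graph. -/
abbrev ProperEdgeColoring {V : Type*} (G : SimpleGraph V) (k : ℕ) : Type _ :=
  G.lineGraph.Coloring (Fin k)

/-- The color-set of the vertex `v`: the colors on the edges incident with `v`. -/
def colorSet {V : Type*} {G : SimpleGraph V} {k : ℕ} (c : G.ProperEdgeColoring k) (v : V) :
    Set (Fin k) :=
  {a | ∃ e : G.edgeSet, v ∈ (e : Sym2 V) ∧ c e = a}

/-- Distinct vertices have distinct color-sets. -/
def IsVertexDistinguishing {V : Type*} {G : SimpleGraph V} {k : ℕ}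
    (c : G.ProperEdgeColoring k) : Prop :=
  ∀ u v : V, u ≠ v → colorSet c u ≠ colorSet c v

/-- The vertex-distinguishing chromatic index: the least `k ≥ 1` such that `G` has a
vertex-distinguishing edge-`k`-coloring, and `⊤` if there is no such `k`. -/
noncomputable def vdChromaticIndex {V : Type*} (G : SimpleGraph V) : ℕ∞ :=
  ⨅ k ∈ {k : ℕ | 1 ≤ k ∧ ∃ c : G.ProperEdgeColoring k, IsVertexDistinguishing c}, (k : ℕ∞)

/-- The number of vertices of degree `d`. -/
def numDegree {V : Type*} [Fintype V] (G : SimpleGraph V) [DecidableRel G.Adj] (d : ℕ) : ℕ :=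
  (Finset.univ.filter fun v : V => G.degree v = d).card

/-- The least `k` such that `k.choose d ≥ n_d` for every `d` between the minimum and the maximum
degree, where `n_d` is the number of vertices of degree `d`. -/
noncomputable def vdLowerBound {V : Type*} [Fintype V] (G : SimpleGraph V)
    [DecidableRel G.Adj] : ℕ :=
  sInf {k : ℕ | ∀ d ∈ Finset.Icc G.minDegree G.maxDegree, G.numDegree d ≤ k.choose d}

/-- For a vdec graph the minimum in `vdLowerBound` is over a nonempty set. -/
theorem IsVdec.exists_choose_ge {V : Type*} [Fintype V] {G : SimpleGraph V}
    [DecidableRel G.Adj] (hG : G.IsVdec) :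
    {k : ℕ | ∀ d ∈ Finset.Icc G.minDegree G.maxDegree, G.numDegree d ≤ k.choose d}.Nonempty := by
  refine ⟨2 * Fintype.card V, fun d hd => ?_⟩
  have hn : G.numDegree d ≤ Fintype.card V := Finset.card_le_univ _
  rcases Nat.eq_zero_or_pos d with rfl | hpos
  · rw [Nat.choose_zero_right]
    refine Finset.card_le_one.2 fun u hu v hv => hG.1 u v ?_ ?_
    · intro w hw
      have h0 := (Finset.mem_filter.1 hu).2
      have := (G.degree_pos_iff_exists_adj u).2 ⟨w, hw⟩
      omega
    · intro w hw
      have h0 := (Finset.mem_filter.1 hv).2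
      have := (G.degree_pos_iff_exists_adj v).2 ⟨w, hw⟩
      omega
  · rcases Nat.eq_zero_or_pos (G.numDegree d) with h0 | h0
    · omega
    obtain ⟨v, hv⟩ := Finset.card_pos.1 h0
    have hd' : d < Fintype.card V := by
      rw [← (Finset.mem_filter.1 hv).2]
      exact G.degree_lt_card_verts v
    have h1 : Fintype.card V ≤ (Fintype.card V + d - 1).choose d := by
      have h2 : (Fintype.card V + d - 1).choose d
          = (Fintype.card V + d - 1).choose (Fintype.card V - 1) := by
        rw [← Nat.choose_symm (by omega : d ≤ Fintype.card V + d - 1)]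
        congr 1
        omega
      rw [h2]
      calc Fintype.card V = (Fintype.card V).choose (Fintype.card V - 1) := by
            rw [← Nat.choose_symm (by omega : Fintype.card V - 1 ≤ Fintype.card V)]
            rw [show Fintype.card V - (Fintype.card V - 1) = 1 by omega, Nat.choose_one_right]
        _ ≤ _ := Nat.choose_le_choose _ (by omega)
    exact hn.trans (h1.trans (Nat.choose_le_choose _ (by omega)))

end SimpleGraph

/-! The proof is a counting induction on edge sets, in the style of Rosenfeld, and gives the
stronger bound `5k + 6`, where `k` is `vdLowerBound`. Count all functions from edges to `C`, with
`|C| = 5k + 6`, that are good on `F`. The claim (`two_mul_card_good_erase_le`) is that imposing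
goodness at one more edge `e` keeps at least a fraction `2k / |C|` of them: on average, `e` has at
least `2k` admissible colours.

A function lost on adding `e` either repeats a colour at an end of `e`, or is proper but gives an
end `u` the same colours as some `v` of equal degree. In the latter case the colours on `T = I u \ I
v` are determined, up to `|T|!` orders, by those off `T`. Forgetting `T` costs, by induction, a
factor of at most `|C| / 2k` per edge other than `e`. Since at most `choose k d` vertices have
degree `d`, the losses sum to `3k / (2|C|)` at each end, plus `4 / |C|` for a conflict between the
two ends, and `5k + 6 - 3k - 4 ≥ 2k`. -/

namespace VertexDistinguishing

open Finset

/-! ### Counting functions by their values off a set -/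

section Counting

variable {E C : Type*} [Fintype E] [DecidableEq E] [Fintype C] [DecidableEq C]

/-- If `A` is closed under changing coordinates in `T`, and at most `r` members of `B ⊆ A` agree
with any given function outside `T`, then `B` has relative density at most `r / |C| ^ |T|`. -/
theorem card_mul_pow_le (T : Finset E) (A B : Finset (E → C)) (r : ℕ) (hBA : B ⊆ A)
    (hA : ∀ c ∈ A, ∀ c' : E → C, (∀ e ∉ T, c' e = c e) → c' ∈ A)
    (hB : ∀ a : E → C, #{b ∈ B | ∀ e ∉ T, b e = a e} ≤ r) :
    #B * Fintype.card C ^ #T ≤ r * #A := by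
  have hcard : #(B ×ˢ (univ : Finset (T → C))) = #B * Fintype.card C ^ #T := by
    rw [card_product, card_univ, Fintype.card_fun, Fintype.card_coe]
  rw [← hcard]
  -- Overwrite a member of `B` on `T` in every possible way; the results stay in `A`, and each
  -- arises at most `r` times.
  let f : (E → C) × (T → C) → E → C := fun p e => if h : e ∈ T then p.2 ⟨e, h⟩ else p.1 e
  refine card_le_mul_card_image_of_maps_to (f := f) ?_ r ?_
  · rintro ⟨b, t⟩ hp
    refine hA b (hBA (mem_product.1 hp).1) _ fun e he => ?_
    simp [f, he]
  · intro a _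
    refine le_trans (card_le_card_of_injOn Prod.fst ?_ ?_) (hB a)
    · rintro ⟨b, t⟩ hp
      simp only [coe_filter, Set.mem_ofPred_eq, mem_product] at hp
      obtain ⟨⟨hb, -⟩, rfl⟩ := hp
      simp only [coe_filter, Set.mem_ofPred_eq]
      exact ⟨hb, fun e he => by simp [f, he]⟩
    · rintro ⟨b, t⟩ hp ⟨b', t'⟩ hp' hbb
      simp only [coe_filter, Set.mem_ofPred_eq, mem_product] at hp hp'
      have hbb' : b = b' := hbb
      subst hbb'
      have htt : t = t' := by
        funext x
        have h := congrFun (hp.2.trans hp'.2.symm) x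
        simpa [f] using h
      rw [htt]

/-- Fixing the values off `T` fixes the colour set of `Y`; the values on `T` are then a bijection
onto that set, which leaves at most `|T|!` choices. -/
theorem card_image_eq_image_mul_pow_le (T Y : Finset E) (A B : Finset (E → C)) (hTY : Disjoint T Y)
    (hBA : B ⊆ A) (hA : ∀ c ∈ A, ∀ c' : E → C, (∀ e ∉ T, c' e = c e) → c' ∈ A)
    (hB : ∀ c ∈ B, Set.InjOn c T ∧ T.image c = Y.image c) :
    #B * Fintype.card C ^ #T ≤ (#T).factorial * #A := by
  refine card_mul_pow_le T A B _ hBA hA fun a => ?_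
  have himage : ∀ b ∈ B.filter (fun b => ∀ e ∉ T, b e = a e), T.image b = Y.image a := by
    intro b hb
    rw [mem_filter] at hb
    rw [(hB b hb.1).2]
    exact image_congr fun e he => hb.2 e fun h => disjoint_left.1 hTY h he
  rcases (B.filter (fun b => ∀ e ∉ T, b e = a e)).eq_empty_or_nonempty with h0 | ⟨b₀, hb₀⟩
  · rw [h0]
    simp
  have hX : #(Y.image a) = #T := by
    rw [← himage b₀ hb₀]
    exact card_image_of_injOn (hB b₀ (mem_filter.1 hb₀).1).1
  have hemb : Fintype.card (T ↪ Y.image a) = (#T).factorial := by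
    rw [Fintype.card_embedding_eq, Fintype.card_coe, Fintype.card_coe, hX, Nat.descFactorial_self]
  rw [← hemb, ← Fintype.card_coe]
  refine Fintype.card_le_of_injective
    (fun b => (⟨fun x => ⟨b.1 x.1, ?_⟩, ?_⟩ : T ↪ Y.image a)) ?_
  · rw [← himage b.1 b.2]
    exact mem_image_of_mem _ x.2
  · intro x y hxy
    exact Subtype.ext ((hB b.1 (mem_filter.1 b.2).1).1 x.2 y.2 (congrArg Subtype.val hxy))
  · intro b b' hbb
    refine Subtype.ext (funext fun e => ?_)
    by_cases he : e ∈ T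
    · have h := DFunLike.congr_fun hbb ⟨e, he⟩
      exact congrArg Subtype.val h
    · rw [(mem_filter.1 b.2).2 e he, (mem_filter.1 b'.2).2 e he]

end Counting

/-! ### Good functions and their restrictions -/

section Good

variable {V E C : Type*} [DecidableEq C]

/-- `c` is proper on the edges in `F`, and it distinguishes those vertices of equal degree all of
whose edges lie in `F`. Here `I v` is the set of edges at `v`. -/
def IsGood (I : V → Finset E) (F : Finset E) (c : E → C) : Prop :=
  (∀ v, ∀ e ∈ I v, e ∈ F → ∀ f ∈ I v, f ∈ F → c e = c f → e = f) ∧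
    ∀ u v, u ≠ v → #(I u) = #(I v) → I u ⊆ F → I v ⊆ F → (I u).image c ≠ (I v).image c

theorem IsGood.mono {I : V → Finset E} {F F' : Finset E} (h : F' ⊆ F) {c : E → C}
    (hc : IsGood I F c) : IsGood I F' c :=
  ⟨fun v e he he' f hf hf' => hc.1 v e he (h he') f hf (h hf'),
    fun u v huv hd hu hv => hc.2 u v huv hd (hu.trans h) (hv.trans h)⟩

theorem IsGood.congr {I : V → Finset E} {F : Finset E} {c c' : E → C} (hc : IsGood I F c)
    (h : ∀ e ∈ F, c' e = c e) : IsGood I F c' := by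
  refine ⟨fun v e he he' f hf hf' hef => hc.1 v e he he' f hf hf' ?_,
    fun u v huv hd hu hv => ?_⟩
  · rw [← h e he', ← h f hf', hef]
  · rw [image_congr (fun e he => h e (hu he)), image_congr (fun e he => h e (hv he))]
    exact hc.2 u v huv hd hu hv

variable [Fintype E] [DecidableEq E] [Fintype C]

open Classical in
/-- The functions that are good on `F`. -/
noncomputable def good (I : V → Finset E) (C : Type*) [Fintype C] [DecidableEq C] (F : Finset E) :
    Finset (E → C) :=
  univ.filter (IsGood I F)

theorem mem_good {I : V → Finset E} {F : Finset E} {c : E → C} :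
    c ∈ good I C F ↔ IsGood I F c := by
  simp [good]

theorem good_anti {I : V → Finset E} {F F' : Finset E} (h : F' ⊆ F) :
    good I C F ⊆ good I C F' :=
  fun _ hc => mem_good.2 ((mem_good.1 hc).mono h)

theorem good_sdiff_closed {I : V → Finset E} {F T : Finset E} (c : E → C)
    (hc : c ∈ good I C (F \ T)) (c' : E → C) (h : ∀ e ∉ T, c' e = c e) :
    c' ∈ good I C (F \ T) :=
  mem_good.2 ((mem_good.1 hc).congr fun e he => h e (mem_sdiff.1 he).2)

/-- For `e ∉ F`, the colour of `e` hits a given other colour with probability `1 / |C|`. -/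
theorem card_good_eq_color_le (I : V → Finset E) (F : Finset E) (e f : E) (he : e ∉ F)
    (hef : f ≠ e) :
    #((good I C F).filter fun c => c e = c f) * Fintype.card C ≤ #(good I C F) := by
  have h := card_mul_pow_le {e} (good I C F) ((good I C F).filter fun c => c e = c f) 1
    (filter_subset _ _) ?_ ?_
  · simpa using h
  · intro c hc c' h
    refine mem_good.2 ((mem_good.1 hc).congr fun x hx => h x ?_)
    rw [mem_singleton]
    rintro rfl
    exact he hx
  · intro a
    rw [card_le_one]
    intro b hb b' hb'
    simp only [mem_filter, mem_singleton] at hb hb'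
    funext x
    by_cases hx : x = e
    · rw [hx, hb.1.2, hb'.1.2, hb.2 f hef, hb'.2 f hef]
    · rw [hb.2 x hx, hb'.2 x hx]

theorem card_conflict_mul_pow_le (I : V → Finset E) (F : Finset E) (u v : V)
    (B : Finset (E → C)) (hB : B ⊆ good I C F)
    (hinj : ∀ c ∈ B, Set.InjOn c (I u) ∧ Set.InjOn c (I v) ∧ (I u).image c = (I v).image c) :
    #B * Fintype.card C ^ #(I u \ I v) ≤
      (#(I u \ I v)).factorial * #(good I C (F \ (I u \ I v))) := by
  -- By injectivity, shared edges cancel from the equality of images, leaving two disjoint sets with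
  -- equal images.
  have hsdiff : ∀ (c : E → C) (S T : Finset E), Set.InjOn c S → S.image c = T.image c →
      ∀ e ∈ S \ T, c e ∈ (T \ S).image c := by
    intro c S T hS hST e he
    rw [mem_sdiff] at he
    have h1 : c e ∈ T.image c := hST ▸ mem_image_of_mem c he.1
    obtain ⟨f, hf, hfe⟩ := mem_image.1 h1
    refine mem_image.2 ⟨f, mem_sdiff.2 ⟨hf, fun hfS => he.2 ?_⟩, hfe⟩
    rwa [← hS hfS he.1 hfe]
  refine card_image_eq_image_mul_pow_le _ (I v \ I u) _ B ?_ (hB.trans (good_anti sdiff_subset))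
    good_sdiff_closed ?_
  · exact disjoint_sdiff_self_left.mono_right sdiff_subset
  · intro c hc
    obtain ⟨h1, h2, h3⟩ := hinj c hc
    refine ⟨h1.mono (by simp), subset_antisymm ?_ ?_⟩
    · exact image_subset_iff.2 (hsdiff c _ _ h1 h3)
    · exact image_subset_iff.2 (hsdiff c _ _ h2 h3.symm)

/-- Telescoping of the one-edge inequality. It trades goodness off `T` for goodness on `F`. -/
theorem pow_mul_card_good_sdiff_le (I : V → Finset E) (F : Finset E) (β : ℕ)
    (h : ∀ F' ⊆ F, ∀ e ∈ F', β * #(good I C (F'.erase e)) ≤ Fintype.card C * #(good I C F'))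
    (T : Finset E) (hT : T ⊆ F) :
    β ^ #T * #(good I C (F \ T)) ≤ Fintype.card C ^ #T * #(good I C F) := by
  induction T using Finset.induction_on with
  | empty => simp
  | insert a T ha ih =>
    have h1 := ih ((subset_insert _ _).trans hT)
    have h2 := h (F \ T) sdiff_subset a
      (mem_sdiff.2 ⟨hT (mem_insert_self _ _), ha⟩)
    rw [sdiff_insert, card_insert_of_notMem ha, pow_succ, pow_succ]
    calc β ^ #T * β * #(good I C ((F \ T).erase a))
        = β ^ #T * (β * #(good I C ((F \ T).erase a))) := by ring
      _ ≤ β ^ #T * (Fintype.card C * #(good I C (F \ T))) := Nat.mul_le_mul_left _ h2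
      _ = Fintype.card C * (β ^ #T * #(good I C (F \ T))) := by ring
      _ ≤ Fintype.card C * (Fintype.card C ^ #T * #(good I C F)) := Nat.mul_le_mul_left _ h1
      _ = _ := by ring

end Good

end VertexDistinguishing

namespace VertexDistinguishing

open Finset

/-! ### Factorial estimates -/

theorem factorial_succ_le_pow (m : ℕ) : (m + 1).factorial ≤ (m + 1) ^ m := by
  induction m with
  | zero => simp
  | succ m ih =>
    rw [Nat.factorial_succ, pow_succ']
    exact Nat.mul_le_mul_left _ (ih.trans (Nat.pow_le_pow_left (by omega) _))

theorem choose_mul_factorial_div_le (k m : ℕ) (hk : 0 < k) :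
    (k.choose (m + 1) : ℝ) * ((m + 1).factorial / (2 * k : ℝ) ^ m) ≤ k / 2 ^ m := by
  have h1 : (m + 1).factorial * k.choose (m + 1) ≤ k ^ (m + 1) := by
    rw [← Nat.descFactorial_eq_factorial_mul_choose]
    exact Nat.descFactorial_le_pow _ _
  have h2 : ((m + 1).factorial * k.choose (m + 1) : ℝ) ≤ k ^ (m + 1) := by exact_mod_cast h1
  have hk' : (0 : ℝ) < k := by exact_mod_cast hk
  rw [← mul_div_assoc, div_le_div_iff₀ (by positivity) (by positivity), mul_pow]
  calc (k.choose (m + 1) : ℝ) * (m + 1).factorial * 2 ^ m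
      = ((m + 1).factorial * k.choose (m + 1) : ℝ) * 2 ^ m := by ring
    _ ≤ k ^ (m + 1) * 2 ^ m := by gcongr
    _ = _ := by ring

theorem factorial_div_pow_le (k m : ℕ) (hk : m + 1 ≤ k) :
    ((m + 1).factorial : ℝ) / (2 * k : ℝ) ^ m ≤ 1 / 2 ^ m := by
  have h1 : (m + 1).factorial ≤ k ^ m :=
    (factorial_succ_le_pow m).trans (Nat.pow_le_pow_left hk m)
  have h2 : ((m + 1).factorial : ℝ) ≤ k ^ m := by exact_mod_cast h1
  have hk' : (0 : ℝ) < k := by exact_mod_cast (by omega : 0 < k)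
  rw [div_le_div_iff₀ (by positivity) (by positivity), mul_pow]
  nlinarith [pow_pos (zero_lt_two' ℝ) m]

/-! ### Counting conflicts created by one edge -/

section Conflict

variable {V E C : Type*} [Fintype V] [Fintype E] [DecidableEq E] [Fintype C]
  [DecidableEq C]

open Classical in
/-- The functions that are good on `F \ {e}` and proper on `F`, but give the vertices `u` and `v`,
all of whose edges lie in `F`, the same colours. -/
noncomputable def conflict (I : V → Finset E) (C : Type*) [Fintype C] [DecidableEq C]
    (F : Finset E) (e : E) (u v : V) : Finset (E → C) :=
  (good I C (F.erase e)).filter fun c =>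
    (∀ w, Set.InjOn c (I w ∩ F : Finset E)) ∧ I u ⊆ F ∧ I v ⊆ F ∧ (I u).image c = (I v).image c

theorem card_conflict_mul_le (I : V → Finset E) (F : Finset E) (e : E) (u v : V) :
    #(conflict I C F e u v) * Fintype.card C ^ #(I u \ I v) ≤
      (#(I u \ I v)).factorial * #(good I C (F.erase e \ (I u \ I v))) := by
  refine card_conflict_mul_pow_le I (F.erase e) u v _ (filter_subset _ _) fun c hc => ?_
  obtain ⟨-, h1, h2, h3, h4⟩ := mem_filter.1 hc
  refine ⟨?_, ?_, h4⟩
  · simpa [inter_eq_left.2 h2] using h1 u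
  · simpa [inter_eq_left.2 h3] using h1 v

variable (I : V → Finset E) (F : Finset E) (e : E) (β : ℕ)

/-- Here `e` belongs to `I u \ I v` but is already absent from `F.erase e`, so only the other `t`
edges pay the factor `|C| / β`; `e` contributes a full `1 / |C|`. -/
theorem card_conflict_of_notMem (hC : 0 < Fintype.card C)
    (hβ : ∀ F' ⊆ F.erase e, ∀ f ∈ F',
      β * #(good I C (F'.erase f)) ≤ Fintype.card C * #(good I C F'))
    (u v : V) (hu : e ∈ I u) (hv : e ∉ I v) (t : ℕ) (ht : #(I u \ I v) = t + 1) :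
    Fintype.card C * β ^ t * #(conflict I C F e u v) ≤
      (t + 1).factorial * #(good I C (F.erase e)) := by
  by_cases hF : I u ⊆ F
  swap
  · have h0 : conflict I C F e u v = ∅ := by
      rw [conflict, filter_eq_empty_iff]
      exact fun c _ h => hF h.2.1
    simp [h0]
  have heT : e ∈ I u \ I v := mem_sdiff.2 ⟨hu, hv⟩
  have h1 := card_conflict_mul_le (C := C) I F e u v
  have h2 := pow_mul_card_good_sdiff_le (C := C) I (F.erase e) β hβ ((I u \ I v).erase e)
    (erase_subset_erase _ (sdiff_subset.trans hF))
  have h3 : F.erase e \ (I u \ I v).erase e = F.erase e \ (I u \ I v) := by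
    ext f
    simp only [mem_sdiff, mem_erase]
    tauto
  rw [h3, card_erase_of_mem heT, ht, Nat.add_sub_cancel] at h2
  rw [ht] at h1
  refine Nat.le_of_mul_le_mul_right ?_ (pow_pos hC t)
  calc Fintype.card C * β ^ t * #(conflict I C F e u v) * Fintype.card C ^ t
      = β ^ t * (#(conflict I C F e u v) * Fintype.card C ^ (t + 1)) := by ring
    _ ≤ β ^ t * ((t + 1).factorial * #(good I C (F.erase e \ (I u \ I v)))) :=
        Nat.mul_le_mul_left _ h1
    _ = (t + 1).factorial * (β ^ t * #(good I C (F.erase e \ (I u \ I v)))) := by ring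
    _ ≤ (t + 1).factorial * (Fintype.card C ^ t * #(good I C (F.erase e))) :=
        Nat.mul_le_mul_left _ h2
    _ = _ := by ring

/-- With `e` at `v`, the set `I u \ I v` avoids `e`, so every one of its edges pays `|C| / β` and
the gain is only `1 / β` per edge. It serves for the two ends of `e`. -/
theorem card_conflict_of_mem (hC : 0 < Fintype.card C)
    (hβ : ∀ F' ⊆ F.erase e, ∀ f ∈ F',
      β * #(good I C (F'.erase f)) ≤ Fintype.card C * #(good I C F'))
    (u v : V) (hv : e ∈ I v) :
    β ^ #(I u \ I v) * #(conflict I C F e u v) ≤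
      (#(I u \ I v)).factorial * #(good I C (F.erase e)) := by
  by_cases hF : I u ⊆ F
  swap
  · have h0 : conflict I C F e u v = ∅ := by
      rw [conflict, filter_eq_empty_iff]
      exact fun c _ h => hF h.2.1
    simp [h0]
  have h1 := card_conflict_mul_le (C := C) I F e u v
  have h2 := pow_mul_card_good_sdiff_le (C := C) I (F.erase e) β hβ (I u \ I v) (fun f hf => by
    rw [mem_sdiff] at hf
    exact mem_erase.2 ⟨fun h => hf.2 (h ▸ hv), hF hf.1⟩)
  refine Nat.le_of_mul_le_mul_right ?_ (pow_pos hC #(I u \ I v))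
  calc β ^ #(I u \ I v) * #(conflict I C F e u v) * Fintype.card C ^ #(I u \ I v)
      = β ^ #(I u \ I v) * (#(conflict I C F e u v) * Fintype.card C ^ #(I u \ I v)) := by ring
    _ ≤ β ^ #(I u \ I v) * ((#(I u \ I v)).factorial * #(good I C (F.erase e \ (I u \ I v)))) :=
        Nat.mul_le_mul_left _ h1
    _ = (#(I u \ I v)).factorial *
          (β ^ #(I u \ I v) * #(good I C (F.erase e \ (I u \ I v)))) := by ring
    _ ≤ (#(I u \ I v)).factorial *
          (Fintype.card C ^ #(I u \ I v) * #(good I C (F.erase e))) := Nat.mul_le_mul_left _ h2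
    _ = _ := by ring

variable [DecidableEq V]

/-- A function that is good on `F \ {e}` but not on `F` repeats the colour of `e` at an end of `e`
or leaves an end of `e` in conflict with another vertex. -/
theorem card_good_erase_le (u x : V) (hux : u ≠ x) (hends : ∀ v, e ∈ I v ↔ v = u ∨ v = x) :
    #(good I C (F.erase e)) ≤ #(good I C F) + (
      (∑ f ∈ (I u).erase e, #((good I C (F.erase e)).filter fun c => c e = c f) +
        ∑ v with v ≠ u ∧ v ≠ x ∧ #(I v) = #(I u), #(conflict I C F e u v)) +
      (∑ f ∈ (I x).erase e, #((good I C (F.erase e)).filter fun c => c e = c f) +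
        ∑ v with v ≠ x ∧ v ≠ u ∧ #(I v) = #(I x), #(conflict I C F e x v)) +
      if #(I u) = #(I x) then #(conflict I C F e u x) else 0) := by
  have hsub : good I C (F.erase e) ⊆ good I C F ∪ (
      (((I u).erase e).biUnion (fun f => (good I C (F.erase e)).filter fun c => c e = c f) ∪
        (univ.filter fun v => v ≠ u ∧ v ≠ x ∧ #(I v) = #(I u)).biUnion (conflict I C F e u)) ∪
      (((I x).erase e).biUnion (fun f => (good I C (F.erase e)).filter fun c => c e = c f) ∪
        (univ.filter fun v => v ≠ x ∧ v ≠ u ∧ #(I v) = #(I x)).biUnion (conflict I C F e x)) ∪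
      if #(I u) = #(I x) then conflict I C F e u x else ∅) := by
    intro c hc
    by_contra hnot
    simp only [mem_union, mem_biUnion, mem_erase, mem_filter, mem_univ, true_and, not_or,
      not_exists, not_and] at hnot
    obtain ⟨hgood, ⟨⟨hpu, hqu⟩, hpx, hqx⟩, hux'⟩ := hnot
    have hg := mem_good.1 hc
    have hne : ∀ w, ∀ f ∈ I w, e ∈ I w → f ≠ e → c e ≠ c f := by
      intro w f hf hew hfe
      rcases (hends w).1 hew with rfl | rfl
      · exact hpu f ⟨hfe, hf⟩ hc
      · exact hpx f ⟨hfe, hf⟩ hc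
    have hproper : ∀ w, ∀ f ∈ I w, f ∈ F → ∀ g ∈ I w, g ∈ F → c f = c g → f = g := by
      intro w f hf hf' g hg1 hg2 hfg
      by_cases hfe : f = e
      · subst hfe
        by_contra h
        exact hne w g hg1 hf (Ne.symm h) hfg
      by_cases hge : g = e
      · subst hge
        exact absurd hfg.symm (hne w f hf hg1 hfe)
      exact hg.1 w f hf (mem_erase.2 ⟨hfe, hf'⟩) g hg1 (mem_erase.2 ⟨hge, hg2⟩) hfg
    have hinj : ∀ w, Set.InjOn c (I w ∩ F : Finset E) := by
      intro w f hf g hg' hfg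
      rw [mem_coe, mem_inter] at hf hg'
      exact hproper w f hf.1 hf.2 g hg'.1 hg'.2 hfg
    have hmem : ∀ a b, I a ⊆ F → I b ⊆ F → (I a).image c = (I b).image c →
        c ∈ conflict I C F e a b := fun a b ha hb hab =>
      mem_filter.2 ⟨hc, hinj, ha, hb, hab⟩
    have hend : ∀ a b, a ≠ b → #(I a) = #(I b) → I a ⊆ F → I b ⊆ F →
        (I a).image c = (I b).image c → e ∉ I a := by
      intro a b hab hd ha hb him hea
      rcases (hends a).1 hea with rfl | rfl
      · by_cases hbx : b = x
        · subst hbx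
          rw [if_pos hd] at hux'
          exact hux' (hmem _ _ ha hb him)
        · exact hqu b ⟨hab.symm, hbx, hd.symm⟩ (hmem _ _ ha hb him)
      · by_cases hbu : b = u
        · subst hbu
          rw [if_pos hd.symm] at hux'
          exact hux' (hmem _ _ hb ha him.symm)
        · exact hqx b ⟨hab.symm, hbu, hd.symm⟩ (hmem _ _ ha hb him)
    refine hgood (mem_good.2 ⟨hproper, fun a b hab hd ha hb him => ?_⟩)
    -- A conflicting pair that avoids `e` would already conflict on `F.erase e`.
    have h1 := hend a b hab hd ha hb him
    have h2 := hend b a hab.symm hd.symm hb ha him.symm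
    exact hg.2 a b hab hd (subset_erase.2 ⟨ha, h1⟩) (subset_erase.2 ⟨hb, h2⟩) him
  refine (card_le_card hsub).trans ((card_union_le _ _).trans (Nat.add_le_add_left ?_ _))
  refine (card_union_le _ _).trans (Nat.add_le_add ((card_union_le _ _).trans
    (Nat.add_le_add ?_ ?_)) ?_)
  · exact (card_union_le _ _).trans (Nat.add_le_add card_biUnion_le card_biUnion_le)
  · exact (card_union_le _ _).trans (Nat.add_le_add card_biUnion_le card_biUnion_le)
  · split_ifs <;> simp

end Conflict

end VertexDistinguishing

namespace VertexDistinguishing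

open Finset

/-! ### Summing the losses and running the induction -/

variable {V E : Type*} [DecidableEq E]

/-- Send `v` to an edge shared with `u`: it is not `e`, and its only other end is `v`, so the map is
injective. -/
theorem card_adjacent_le (I : V → Finset E) (e : E) (u x : V)
    (hends : ∀ f, ∃ a b, a ≠ b ∧ ∀ v, f ∈ I v ↔ v = a ∨ v = b) (he : ∀ v, e ∈ I v ↔ v = u ∨ v = x)
    (S : Finset V) (hS : ∀ v ∈ S, v ≠ u ∧ v ≠ x ∧ (I u ∩ I v).Nonempty) :
    #S ≤ #(I u) - 1 := by
  rw [← card_erase_of_mem ((he u).2 (Or.inl rfl))]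
  have : Nonempty E := ⟨e⟩
  choose! g hg using fun v hv => (hS v hv).2.2
  refine card_le_card_of_injOn g (fun v hv => ?_) fun v hv w hw hvw => ?_
  · have h := mem_inter.1 (hg v hv)
    refine mem_erase.2 ⟨fun h' => ?_, h.1⟩
    rw [h'] at h
    rcases (he v).1 h.2 with h1 | h1
    · exact (hS v hv).1 h1
    · exact (hS v hv).2.1 h1
  · obtain ⟨a, b, -, hab⟩ := hends (g v)
    have h1 := mem_inter.1 (hg v hv)
    have h2 := mem_inter.1 (hg w hw)
    rw [← hvw] at h2
    have hu := (hab u).1 h1.1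
    have hv' := (hab v).1 h1.2
    have hw' := (hab w).1 h2.2
    have hvu := (hS v hv).1
    have hwu := (hS w hw).1
    grind

variable {C : Type*} [Fintype V] [DecidableEq V] [Fintype E] [Fintype C] [DecidableEq C]

/-- The bad events at the end `u` of `e` have total probability at most `3k / (2|C|)`. -/
theorem card_bad_at_end_le (I : V → Finset E) (F : Finset E) (e : E) (k : ℕ)
    (hC : 0 < Fintype.card C)
    (hβ : ∀ F' ⊆ F.erase e, ∀ f ∈ F',
      (2 * k) * #(good I C (F'.erase f)) ≤ Fintype.card C * #(good I C F'))
    (u x : V) (hends : ∀ f, ∃ a b, a ≠ b ∧ ∀ v, f ∈ I v ↔ v = a ∨ v = b)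
    (he : ∀ v, e ∈ I v ↔ v = u ∨ v = x)
    (hsimple : ∀ u v, u ≠ v → #(I u ∩ I v) ≤ 1) (hdk : #(I u) ≤ k)
    (hn : #{v | #(I v) = #(I u)} ≤ k.choose #(I u)) :
    (Fintype.card C : ℝ) *
      ((∑ f ∈ (I u).erase e, #((good I C (F.erase e)).filter fun c => c e = c f) +
        ∑ v with v ≠ u ∧ v ≠ x ∧ #(I v) = #(I u), #(conflict I C F e u v) : ℕ) : ℝ) ≤
      3 * k / 2 * #(good I C (F.erase e)) := by
  have heu : e ∈ I u := (he u).2 (Or.inl rfl)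
  obtain ⟨m, hm⟩ : ∃ m, #(I u) = m + 1 := ⟨#(I u) - 1, by have := card_pos.2 ⟨e, heu⟩; omega⟩
  have hk : 0 < k := by omega
  have hk' : (0 : ℝ) < k := by exact_mod_cast hk
  set N : ℝ := (#(good I C (F.erase e)) : ℝ) with hN
  have hN0 : 0 ≤ N := Nat.cast_nonneg _
  set D : Finset V := univ.filter fun v => v ≠ u ∧ v ≠ x ∧ #(I v) = #(I u) with hD
  have hDe : ∀ v ∈ D, e ∉ I v := fun v hv h => by
    obtain ⟨-, h1, h2, -⟩ := mem_filter.1 hv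
    exact ((he v).1 h).elim h1 h2
  -- repeated colours at `u`
  have hP : (Fintype.card C : ℝ) *
      ∑ f ∈ (I u).erase e, (#((good I C (F.erase e)).filter fun c => c e = c f) : ℝ) ≤ m * N := by
    rw [mul_sum]
    refine (sum_le_card_nsmul _ _ N fun f hf => ?_).trans_eq ?_
    · have h := card_good_eq_color_le (C := C) I (F.erase e) e f (notMem_erase e F)
        (mem_erase.1 hf).1
      rw [mul_comm, hN]
      exact_mod_cast h
    · rw [card_erase_of_mem heu, hm, nsmul_eq_mul, Nat.add_sub_cancel]
  -- vertices disjoint from `u`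
  have hQ1 : (Fintype.card C : ℝ) *
      ∑ v ∈ D with ¬ (I u ∩ I v).Nonempty, (#(conflict I C F e u v) : ℝ) ≤ k / 2 ^ m * N := by
    rw [mul_sum]
    refine (sum_le_card_nsmul _ _ (((m + 1).factorial / (2 * k : ℝ) ^ m) * N) fun v hv => ?_).trans
      ?_
    · obtain ⟨hv, hdisj⟩ := mem_filter.1 hv
      rw [not_nonempty_iff_eq_empty, ← disjoint_iff_inter_eq_empty] at hdisj
      have h := card_conflict_of_notMem I F e (2 * k) hC hβ u v heu (hDe v hv) m
        (by rw [sdiff_eq_self_of_disjoint hdisj, hm])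
      have h' : (Fintype.card C : ℝ) * (2 * k) ^ m * #(conflict I C F e u v) ≤
        (m + 1).factorial * N := by
          rw [hN]
          exact_mod_cast h
      rw [div_mul_eq_mul_div, le_div_iff₀ (by positivity)]
      linarith
    · rw [nsmul_eq_mul, ← mul_assoc]
      refine mul_le_mul_of_nonneg_right (le_trans ?_ (choose_mul_factorial_div_le k m hk)) hN0
      refine mul_le_mul_of_nonneg_right ?_ (by positivity)
      rw [hm] at hn
      refine Nat.cast_le.2 (le_trans (card_le_card fun v hv => ?_) hn)
      have := (mem_filter.1 (mem_filter.1 hv).1).2.2.2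
      exact mem_filter.2 ⟨mem_univ _, by omega⟩
  have hsplit : ((∑ f ∈ (I u).erase e, #((good I C (F.erase e)).filter fun c => c e = c f) +
        ∑ v ∈ D, #(conflict I C F e u v) : ℕ) : ℝ) =
      ∑ f ∈ (I u).erase e, (#((good I C (F.erase e)).filter fun c => c e = c f) : ℝ) +
        (∑ v ∈ D with (I u ∩ I v).Nonempty, (#(conflict I C F e u v) : ℝ) +
          ∑ v ∈ D with ¬ (I u ∩ I v).Nonempty, (#(conflict I C F e u v) : ℝ)) := by
    rw [sum_filter_add_sum_filter_not]
    push_cast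
    rfl
  rw [hsplit]
  have hadj := card_adjacent_le I e u x hends he (D.filter fun v => (I u ∩ I v).Nonempty)
    fun v hv => by
      obtain ⟨hv, h⟩ := mem_filter.1 hv
      obtain ⟨-, h1, h2, -⟩ := mem_filter.1 hv
      exact ⟨h1, h2, h⟩
  rw [hm, Nat.add_sub_cancel] at hadj
  rcases m with _ | m
  -- If `e` is the only edge at `u`, only the disjoint vertices contribute, and the loss is at most
  -- `k`.
  · have h0 : D.filter (fun v => (I u ∩ I v).Nonempty) = ∅ := card_eq_zero.1 (by omega)
    rw [h0, sum_empty]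
    simp only [pow_zero, div_one, Nat.cast_zero, zero_mul] at hQ1 hP
    nlinarith
  -- vertices sharing an edge other than `e` with `u`
  have hQ2 : (Fintype.card C : ℝ) *
      ∑ v ∈ D with (I u ∩ I v).Nonempty, (#(conflict I C F e u v) : ℝ) ≤ N := by
    rw [mul_sum]
    refine (sum_le_card_nsmul _ _ (((m + 1).factorial / (2 * k : ℝ) ^ m) * N) fun v hv => ?_).trans
      ?_
    · obtain ⟨hv, hne⟩ := mem_filter.1 hv
      have h1 : #(I u ∩ I v) = 1 :=
        le_antisymm (hsimple u v (mem_filter.1 hv).2.1.symm) (card_pos.2 hne)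
      have h2 := card_sdiff_add_card_inter (I u) (I v)
      have h := card_conflict_of_notMem I F e (2 * k) hC hβ u v heu (hDe v hv) m (by omega)
      have h' : (Fintype.card C : ℝ) * (2 * k) ^ m * #(conflict I C F e u v) ≤
        (m + 1).factorial * N := by
          rw [hN]
          exact_mod_cast h
      rw [div_mul_eq_mul_div, le_div_iff₀ (by positivity)]
      linarith
    · rw [nsmul_eq_mul, ← mul_assoc]
      refine mul_le_of_le_one_left hN0 ?_
      -- Now `u` has degree `m + 2`, so at most `m + 1 ≤ 2 ^ m` such vertices occur.
      have h1 : (#(D.filter fun v => (I u ∩ I v).Nonempty) : ℝ) ≤ 2 ^ m := by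
        exact_mod_cast hadj.trans Nat.lt_two_pow_self
      calc _ ≤ (2 : ℝ) ^ m * (1 / 2 ^ m) :=
            mul_le_mul h1 (factorial_div_pow_le k m (by omega)) (by positivity) (by positivity)
        _ = 1 := by field_simp
  have h3 : (k : ℝ) / 2 ^ (m + 1) * N ≤ k / 2 * N := by
    refine mul_le_mul_of_nonneg_right ?_ hN0
    refine div_le_div_of_nonneg_left hk'.le (by norm_num) ?_
    exact le_self_pow₀ one_le_two (by omega)
  have h4 : ((m + 1 : ℕ) : ℝ) * N ≤ (k - 1) * N := by
    refine mul_le_mul_of_nonneg_right ?_ hN0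
    have : ((m + 1 + 1 : ℕ) : ℝ) ≤ k := by exact_mod_cast hm ▸ hdk
    push_cast at this ⊢
    linarith
  linarith

theorem two_mul_card_good_erase_le (I : V → Finset E) (k : ℕ) (hk : 2 ≤ k)
    (hC : Fintype.card C = 5 * k + 6)
    (hends : ∀ e, ∃ u x, u ≠ x ∧ ∀ v, e ∈ I v ↔ v = u ∨ v = x)
    (hsimple : ∀ u v, u ≠ v → #(I u ∩ I v) ≤ 1)
    (hedge : ∀ u x, u ≠ x → (I u ∩ I x).Nonempty → #(I u) = #(I x) → 2 ≤ #(I u))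
    (hdk : ∀ u, #(I u) ≤ k)
    (hn : ∀ u, #{v | #(I v) = #(I u)} ≤ k.choose #(I u)) (F : Finset E) :
    ∀ e ∈ F, (2 * k) * #(good I C (F.erase e)) ≤ Fintype.card C * #(good I C F) := by
  induction F using Finset.strongInduction with
  | H F ih =>
  intro e heF
  have hβ : ∀ F' ⊆ F.erase e, ∀ f ∈ F',
      (2 * k) * #(good I C (F'.erase f)) ≤ Fintype.card C * #(good I C F') :=
    fun F' hF' => ih F' (hF'.trans_ssubset (erase_ssubset heF))
  have hC0 : 0 < Fintype.card C := by omega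
  obtain ⟨u, x, hux, he⟩ := hends e
  have h0 := card_good_erase_le (C := C) I F e u x hux he
  have h1 := card_bad_at_end_le I F e k hC0 hβ u x hends he hsimple (hdk u) (hn u)
  have h2 := card_bad_at_end_le I F e k hC0 hβ x u hends (fun v => (he v).trans or_comm)
    hsimple (hdk x) (hn x)
  have hk' : (2 : ℝ) ≤ k := by exact_mod_cast hk
  -- A conflict between the two ends has density at most `1 / 2k`, and `(5k + 6) / 2k ≤ 4` because
  -- `k ≥ 2`. Degree at least 2 ensures that `I u \ I x` is nonempty.
  have h3 : (Fintype.card C : ℝ) *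
      ((if #(I u) = #(I x) then #(conflict I C F e u x) else 0 : ℕ) : ℝ) ≤
      4 * #(good I C (F.erase e)) := by
    split_ifs with hd
    swap
    · simp
    have heux : e ∈ I u ∩ I x :=
      mem_inter.2 ⟨(he u).2 (Or.inl rfl), (he x).2 (Or.inr rfl)⟩
    have hd2 := hedge u x hux ⟨e, heux⟩ hd
    have h4 : #(I u ∩ I x) = 1 := le_antisymm (hsimple u x hux) (card_pos.2 ⟨e, heux⟩)
    have h5 := card_sdiff_add_card_inter (I u) (I x)
    obtain ⟨m, hm⟩ : ∃ m, #(I u) = m + 2 := ⟨#(I u) - 2, by omega⟩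
    have h6 := card_conflict_of_mem I F e (2 * k) hC0 hβ u x (mem_inter.1 heux).2
    rw [show #(I u \ I x) = m + 1 by omega] at h6
    have h7 : (2 * k : ℝ) ^ (m + 1) * #(conflict I C F e u x) ≤
        (m + 1).factorial * #(good I C (F.erase e)) := by exact_mod_cast h6
    have h8 := factorial_div_pow_le k m (by have := hdk u; omega)
    have h9 : (1 : ℝ) / 2 ^ m ≤ 1 := by
      rw [div_le_one (by positivity)]
      exact one_le_pow₀ one_le_two
    have h10 : ((m + 1).factorial : ℝ) ≤ (2 * k) ^ m := by
      have := h8.trans h9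
      rwa [div_le_one (by positivity)] at this
    have h11 : (2 * k : ℝ) * #(conflict I C F e u x) ≤ #(good I C (F.erase e)) := by
      refine le_of_mul_le_mul_left ?_ (by positivity : (0 : ℝ) < (2 * k) ^ m)
      calc (2 * k : ℝ) ^ m * (2 * k * #(conflict I C F e u x))
          = (2 * k : ℝ) ^ (m + 1) * #(conflict I C F e u x) := by ring
        _ ≤ (m + 1).factorial * #(good I C (F.erase e)) := h7
        _ ≤ _ := mul_le_mul_of_nonneg_right h10 (Nat.cast_nonneg _)
    rw [hC]
    push_cast
    have h12 : (0 : ℝ) ≤ #(conflict I C F e u x) := Nat.cast_nonneg _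
    nlinarith
  have h0' : (#(good I C (F.erase e)) : ℝ) ≤ _ := Nat.cast_le.2 h0
  rw [Nat.cast_add, Nat.cast_add, Nat.cast_add] at h0'
  have h13 := mul_le_mul_of_nonneg_left h0' (Nat.cast_nonneg (α := ℝ) (Fintype.card C))
  rw [mul_add, mul_add, mul_add] at h13
  have h14 : (2 * k : ℝ) * #(good I C (F.erase e)) ≤ Fintype.card C * #(good I C F) := by
    have h15 : (Fintype.card C : ℝ) = 5 * k + 6 := by exact_mod_cast hC
    have h16 : (Fintype.card C : ℝ) * #(good I C (F.erase e)) =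
      (5 * k + 6) * #(good I C (F.erase e)) := by rw [h15]
    have h17 : (0 : ℝ) ≤ #(good I C (F.erase e)) := Nat.cast_nonneg _
    linarith
  exact_mod_cast h14

theorem exists_isGood_univ (I : V → Finset E) (k : ℕ) (hk : 2 ≤ k)
    (hC : Fintype.card C = 5 * k + 6)
    (hends : ∀ e, ∃ u x, u ≠ x ∧ ∀ v, e ∈ I v ↔ v = u ∨ v = x)
    (hsimple : ∀ u v, u ≠ v → #(I u ∩ I v) ≤ 1)
    (hedge : ∀ u x, u ≠ x → (I u ∩ I x).Nonempty → #(I u) = #(I x) → 2 ≤ #(I u))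
    (hdk : ∀ u, #(I u) ≤ k)
    (hn : ∀ u, #{v | #(I v) = #(I u)} ≤ k.choose #(I u))
    (hisolated : ∀ u v, I u = ∅ → I v = ∅ → u = v) :
    ∃ c : E → C, IsGood I univ c := by
  have h := pow_mul_card_good_sdiff_le (C := C) I univ (2 * k)
    (fun F' _ => two_mul_card_good_erase_le I k hk hC hends hsimple hedge hdk hn F') univ
    (subset_refl _)
  have hC0 : 0 < Fintype.card C := by omega
  -- On the empty edge set only edgeless vertices need distinguishing, and there is at most one.
  have hne : (good I C (univ \ univ)).Nonempty := by
    obtain ⟨a⟩ := Fintype.card_pos_iff.1 hC0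
    refine ⟨fun _ => a, mem_good.2 ⟨fun v e _ he => by simp at he, fun u v huv _ hu hv => ?_⟩⟩
    rw [sdiff_self] at hu hv
    exact absurd (hisolated u v (subset_empty.1 hu) (subset_empty.1 hv)) huv
  have hpos : 0 < (2 * k) ^ #(univ : Finset E) * #(good I C (univ \ univ)) :=
    Nat.mul_pos (pow_pos (by omega) _) (card_pos.2 hne)
  obtain ⟨c, hc⟩ := card_pos.1 (Nat.pos_of_mul_pos_left (hpos.trans_le h))
  exact ⟨c, mem_good.1 hc⟩

end VertexDistinguishing

/-! ### Translation to graphs -/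

namespace SimpleGraph

open Finset

open Classical in
/-- The edges at `v`, as elements of the subtype of edges. -/
noncomputable def edgesAt {V : Type*} [Fintype V] (G : SimpleGraph V) (v : V) :
    Finset G.edgeSet :=
  univ.filter fun e => v ∈ (e : Sym2 V)

variable {V : Type*} [Fintype V] {G : SimpleGraph V}

theorem mem_edgesAt {v : V} {e : G.edgeSet} : e ∈ G.edgesAt v ↔ v ∈ (e : Sym2 V) := by
  simp [edgesAt]

open Classical in
theorem card_edgesAt [DecidableRel G.Adj] (v : V) : #(G.edgesAt v) = G.degree v := by
  rw [← G.card_incidenceFinset_eq_degree v]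
  refine card_bij (fun e _ => (e : Sym2 V)) (fun e he => ?_) (fun e _ f _ h => Subtype.ext h)
    fun e he => ?_
  · rw [mem_incidenceFinset]
    exact ⟨e.2, mem_edgesAt.1 he⟩
  · rw [mem_incidenceFinset] at he
    exact ⟨⟨e, he.1⟩, mem_edgesAt.2 he.2, rfl⟩

theorem exists_ends (e : G.edgeSet) :
    ∃ u x, u ≠ x ∧ ∀ v, e ∈ G.edgesAt v ↔ v = u ∨ v = x := by
  obtain ⟨e, he⟩ := e
  induction e with
  | h u x => exact ⟨u, x, G.ne_of_adj he, fun v => by rw [mem_edgesAt, Sym2.mem_iff]⟩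

open Classical in
theorem card_edgesAt_inter_le {u v : V} (huv : u ≠ v) : #(G.edgesAt u ∩ G.edgesAt v) ≤ 1 := by
  rw [card_le_one]
  intro e he f hf
  rw [mem_inter, mem_edgesAt, mem_edgesAt] at he hf
  exact Subtype.ext (Sym2.eq_of_ne_mem huv he.1 he.2 hf.1 hf.2)

theorem exists_eq_of_degree_eq_one [DecidableRel G.Adj] {u v : V} (h : G.Adj u v)
    (hd : G.degree u = 1) : ∀ w, G.Adj u w → w = v := by
  obtain ⟨a, -, ha⟩ := degree_eq_one_iff_existsUnique_adj.1 hd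
  exact fun w hw => (ha w hw).trans (ha v h).symm

theorem IsVdec.two_le_degree [DecidableRel G.Adj] (hG : G.IsVdec) {u v : V} (h : G.Adj u v)
    (hd : G.degree u = G.degree v) : 2 ≤ G.degree u := by
  have h0 := (G.degree_pos_iff_exists_adj u).2 ⟨v, h⟩
  by_contra h1
  exact hG.2 u v ⟨h, exists_eq_of_degree_eq_one h (by omega),
    exists_eq_of_degree_eq_one h.symm (by omega)⟩

/-- This supplies `k ≥ 2` for the counting argument when there is an edge. -/
theorem IsVdec.exists_two_le_degree [DecidableRel G.Adj] (hG : G.IsVdec) {u v : V}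
    (h : G.Adj u v) : ∃ w, 2 ≤ G.degree w := by
  have h0 := (G.degree_pos_iff_exists_adj u).2 ⟨v, h⟩
  have h1 := (G.degree_pos_iff_exists_adj v).2 ⟨u, h.symm⟩
  by_contra! hlt
  have h2 := hlt u
  have h3 := hlt v
  have := hG.two_le_degree h (by omega)
  omega

theorem IsVdec.numDegree_le_choose [DecidableRel G.Adj] (hG : G.IsVdec) (v : V) :
    G.numDegree (G.degree v) ≤ G.vdLowerBound.choose (G.degree v) :=
  Nat.sInf_mem hG.exists_choose_ge _
    (Finset.mem_Icc.2 ⟨G.minDegree_le_degree v, G.degree_le_maxDegree v⟩)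

/-- Otherwise the binomial coefficient vanishes, although `v` itself is counted. -/
theorem IsVdec.degree_le_vdLowerBound [DecidableRel G.Adj] (hG : G.IsVdec) (v : V) :
    G.degree v ≤ G.vdLowerBound := by
  by_contra h
  have h1 := hG.numDegree_le_choose v
  rw [Nat.choose_eq_zero_of_lt (by omega)] at h1
  have h2 : v ∈ univ.filter fun w : V => G.degree w = G.degree v := by simp
  exact absurd (card_pos.2 ⟨v, h2⟩) (by unfold numDegree at h1; omega)

open Classical in
/-- A function on the edges that is good on all edges is a vertex-distinguishing edge coloring. -/
theorem exists_isVertexDistinguishing_of_isGood [DecidableRel G.Adj] {K : ℕ}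
    (c : G.edgeSet → Fin K) (hc : VertexDistinguishing.IsGood G.edgesAt univ c) :
    ∃ c : G.ProperEdgeColoring K, IsVertexDistinguishing c := by
  have hproper : ∀ {e f : G.edgeSet}, G.lineGraph.Adj e f → c e ≠ c f := fun {e f} hef heq => by
    rw [lineGraph_adj_iff_exists] at hef
    obtain ⟨hne, w, hwe, hwf⟩ := hef
    exact hne (hc.1 w e (mem_edgesAt.2 hwe) (mem_univ _) f (mem_edgesAt.2 hwf) (mem_univ _) heq)
  refine ⟨Coloring.mk c hproper, fun u v huv heq => ?_⟩
  have himage : ∀ w, colorSet (G := G) (Coloring.mk c hproper) w =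
      ((G.edgesAt w).image c : Finset (Fin K)) := by
    intro w
    ext a
    simp only [colorSet, Set.mem_ofPred_eq, coe_image, Set.mem_image, mem_coe, mem_edgesAt]
    rfl
  rw [himage, himage, coe_inj] at heq
  have hcard : ∀ w, #((G.edgesAt w).image c) = #(G.edgesAt w) := fun w =>
    card_image_of_injOn fun e he f hf hef =>
      hc.1 w e he (mem_univ _) f hf (mem_univ _) hef
  -- `IsGood` only separates vertices of equal degree; for a proper colouring, equal colour sets
  -- force equal degrees.
  refine hc.2 u v huv ?_ (subset_univ _) (subset_univ _) heq
  rw [← hcard u, ← hcard v, heq]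

theorem IsVdec.exists_isVertexDistinguishing [DecidableRel G.Adj] (hG : G.IsVdec) :
    ∃ c : G.ProperEdgeColoring (5 * G.vdLowerBound + 6), IsVertexDistinguishing c := by
  classical
  have hisolated : ∀ u v, G.edgesAt u = ∅ → G.edgesAt v = ∅ → u = v := by
    have h : ∀ u, G.edgesAt u = ∅ → G.IsIsolated u := fun u hu w hw => by
      have : (⟨s(u, w), hw⟩ : G.edgeSet) ∈ G.edgesAt u := mem_edgesAt.2 (Sym2.mem_mk_left u w)
      simp [hu] at this
    exact fun u v hu hv => hG.1 u v (h u hu) (h v hv)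
  by_cases hE : ∃ u v, G.Adj u v
  · obtain ⟨u, v, huv⟩ := hE
    obtain ⟨w, hw⟩ := hG.exists_two_le_degree huv
    have hedge : ∀ a b, a ≠ b → (G.edgesAt a ∩ G.edgesAt b).Nonempty →
        #(G.edgesAt a) = #(G.edgesAt b) → 2 ≤ #(G.edgesAt a) := by
      rintro a b hab ⟨e, he⟩ hd
      rw [mem_inter, mem_edgesAt, mem_edgesAt] at he
      rw [card_edgesAt, card_edgesAt] at hd
      rw [card_edgesAt]
      have hadj : G.Adj a b := by
        have h := e.2
        rwa [(Sym2.mem_and_mem_iff hab).1 he, mem_edgeSet] at h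
      exact hG.two_le_degree hadj hd
    obtain ⟨c, hc⟩ := VertexDistinguishing.exists_isGood_univ
      (C := Fin (5 * G.vdLowerBound + 6)) G.edgesAt G.vdLowerBound
      (hw.trans (hG.degree_le_vdLowerBound w)) (Fintype.card_fin _) exists_ends
      (fun _ _ => card_edgesAt_inter_le) hedge
      (fun u => by
        rw [card_edgesAt]
        exact hG.degree_le_vdLowerBound u)
      (fun u => by
        simp only [card_edgesAt]
        exact hG.numDegree_le_choose u)
      hisolated
    exact exists_isVertexDistinguishing_of_isGood c hc
  -- Without edges there is at most one vertex, so any function works.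
  · refine exists_isVertexDistinguishing_of_isGood (fun _ => ⟨0, by omega⟩) ?_
    have hempty : ∀ u, G.edgesAt u = ∅ := fun u => by
      refine eq_empty_of_forall_notMem fun e _ => ?_
      obtain ⟨e, he⟩ := e
      induction e with
      | h a b => exact hE ⟨a, b, he⟩
    refine ⟨fun v e he => by simp [hempty] at he, fun u v huv => ?_⟩
    exact absurd (hisolated u v (hempty u) (hempty v)) huv

end SimpleGraph

theorem theorem1 {V : Type*} [Fintype V] (G : SimpleGraph V) [DecidableRel G.Adj]
    (hG : G.IsVdec) :
    G.vdChromaticIndex ≤ ((⌊(5.5 : ℝ) * (G.vdLowerBound : ℝ) + 6.5⌋₊ : ℕ) : ℕ∞) := by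
  have h1 : G.vdChromaticIndex ≤ ((5 * G.vdLowerBound + 6 : ℕ) : ℕ∞) :=
    iInf₂_le (5 * G.vdLowerBound + 6) ⟨by omega, hG.exists_isVertexDistinguishing⟩
  refine h1.trans (Nat.cast_le.2 (Nat.le_floor ?_))
  have h2 : (0 : ℝ) ≤ G.vdLowerBound := Nat.cast_nonneg _
  push_cast
  linarith
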